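/- Let $G=(V,E)$ be a finite simple graph with minimum degree $D_{\min}\ge 1$. Attach a qubit to each vertex, each qubit being held by a different party, and let $|\psi_G\rangle=\prod_{\{i,j\}\in E}CZ_{ij}\,|+\rangle^{\otimes V}$ be the graph state of $G$. For $0\le p\le \tfrac12$ let $$\rho_G=\sum_{S\subseteq V}(1-p)^{|V|-|S|}\,p^{|S|}\,Z_S\,|\psi_G\rangle\langle\psi_G|\,Z_S,\qquad Z_S=\prod_{v\in S}Z_v,$$ be the graph state after a $Z$-error has occurred on every qubit independently with probability $p$. Say that $\rho_G$ can be purified if for every $\varepsilon>0$ there are a number $n$ of copies and a stochastic LOCC protocol (finitely many rounds in which every party applies a local quantum instrument to all the qubits and ancillas that it holds and announces the outcome, with a final post-selection) which, applied to $\rho_G^{\otimes n}$, succeeds with non-zero probability and then outputs a state $\sigma$ with one qubit per party and $\langle\psi_G|\sigma|\psi_G\rangle\ge 1-\varepsilon$. If $$2(1-p)^{D_{\min}+1}\le (1-p)^{D_{\min}}+p^{D_{\min}},$$ then $\rho_G$ cannot be purified. -/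

import Mathlib

open scoped Matrix

noncomputable section

/-- The tensor product over all parties of local operators `M v : ℂ^(d v) → ℂ^(d' v)`, in the
product basis `∀ v, Fin (d v)`. -/
def localTensor {V : Type*} [Fintype V] {d d' : V → ℕ}
    (M : ∀ v, Matrix (Fin (d' v)) (Fin (d v)) ℂ) :
    Matrix (∀ v, Fin (d' v)) (∀ v, Fin (d v)) ℂ :=
  Matrix.of fun x y => ∏ v, M v (x v) (y v)

/-- Stochastic LOCC protocols with finitely many rounds for parties labelled by `V`, where party `v`
currently holds a system of dimension `d v`, and holds one of dimension `e v` upon success.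
In a round every party `v` applies a quantum instrument to its own system, given by Kraus operators
`M v i` with `∑ i, (M v i)ᴴ * M v i = 1` (party `v` is idle if it has one outcome and the Kraus
operator `1`; ancillas and discarded subsystems are allowed since dimensions may change, and
local randomness is an instrument whose Kraus operators are multiples of `1`). All
outcomes are then announced, and the rest of the protocol may depend on them. A branch ends by being
accepted (success) or rejected (failure). -/
inductive SLOCC {V : Type*} (e : V → ℕ) : (V → ℕ) → Type _
  | accept : SLOCC e e
  | reject (d : V → ℕ) : SLOCC e d
  | round (d : V → ℕ) (k : V → ℕ) (d' : ∀ v, Fin (k v) → ℕ)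
      (M : ∀ (v : V) (i : Fin (k v)), Matrix (Fin (d' v i)) (Fin (d v)) ℂ)
      (complete : ∀ v, ∑ i, (M v i)ᴴ * M v i = 1)
      (next : ∀ o : (∀ v, Fin (k v)), SLOCC e (fun v => d' v (o v))) : SLOCC e d

/-- The unnormalized state output by a protocol, summed over all accepted branches. Its trace is the
probability of success. -/
def SLOCC.output {V : Type*} [Fintype V] [DecidableEq V] {e : V → ℕ} :
    {d : V → ℕ} → SLOCC e d → Matrix (∀ v, Fin (d v)) (∀ v, Fin (d v)) ℂ →
      Matrix (∀ v, Fin (e v)) (∀ v, Fin (e v)) ℂ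
  | _, .accept, ρ => ρ
  | _, .reject _, _ => 0
  | _, .round _ _ _ M _ next, ρ =>
      ∑ o, (next o).output
        (localTensor (fun v => M v (o v)) * ρ * (localTensor (fun v => M v (o v)))ᴴ)

/-- `n` copies of the state `ρ` with one qubit per party. Party `v` holds its qubit of every copy,
i.e. a system of dimension `2 ^ n`, whose basis `Fin (2 ^ n)` is identified with
`Fin n → Fin 2`. -/
def copies {V : Type*} (n : ℕ) (ρ : Matrix (V → Fin 2) (V → Fin 2) ℂ) :
    Matrix (V → Fin (2 ^ n)) (V → Fin (2 ^ n)) ℂ :=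
  Matrix.of fun x y => ∏ c : Fin n,
    ρ (fun v => finFunctionFinEquiv.symm (x v) c) (fun v => finFunctionFinEquiv.symm (y v) c)

/-- Purification of `ρ` to the pure state `ψ` is possible if, for every `ε > 0`, some SLOCC protocol
acting on some number of copies of `ρ` succeeds with non-zero probability and then outputs one copy
of a state whose fidelity with `ψ` is at least `1 - ε`. -/
def Purifiable {V : Type*} [Fintype V] [DecidableEq V]
    (ρ : Matrix (V → Fin 2) (V → Fin 2) ℂ) (ψ : (V → Fin 2) → ℂ) : Prop :=
  ∀ ε : ℝ, 0 < ε → ∃ (n : ℕ) (P : SLOCC (fun _ : V => 2) (fun _ : V => 2 ^ n)),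
    0 < (P.output (copies n ρ)).trace.re ∧
      (1 - ε) * (P.output (copies n ρ)).trace.re ≤
        (star ψ ⬝ᵥ (P.output (copies n ρ) *ᵥ ψ)).re

/-- The graph state of `G`: controlled-phase gates along all edges of `G` applied to `|+⟩` on every
vertex. The gate on the edge `e` multiplies the basis vector `x` by `-1` if both ends of `e` are
in state `1`. -/
def graphState {V : Type*} [Fintype V] [DecidableEq V] (G : SimpleGraph V) [DecidableRel G.Adj] :
    (V → Fin 2) → ℂ :=
  fun x => (∏ e ∈ G.edgeFinset, if ∀ v ∈ e, x v = 1 then (-1 : ℂ) else 1) *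
    ∏ _v : V, ((Real.sqrt 2 : ℝ) : ℂ)⁻¹

/-- Pauli `Z` applied to each of the qubits in `S`. -/
def applyZ {V : Type*} (S : Finset V) (ψ : (V → Fin 2) → ℂ) : (V → Fin 2) → ℂ :=
  fun x => (∏ v ∈ S, (-1 : ℂ) ^ (x v : ℕ)) * ψ x

/-- The graph state of `G` after a `Z`-error has occurred on every qubit independently with
probability `p`. -/
def noisyGraphState {V : Type*} [Fintype V] [DecidableEq V] (G : SimpleGraph V) [DecidableRel G.Adj]
    (p : ℝ) : Matrix (V → Fin 2) (V → Fin 2) ℂ :=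
  ∑ S : Finset V, (((1 - p) ^ (Fintype.card V - S.card) * p ^ S.card : ℝ) : ℂ) •
    Matrix.vecMulVec (applyZ S (graphState G)) (star (applyZ S (graphState G)))

end

/-! The obstruction is positivity of the partial transpose (PPT) at one vertex `v` of minimum
degree. PPT at `v` survives taking copies and every SLOCC protocol
(`partialTranspose_copies_posSemidef`, `partialTranspose_output_posSemidef`), while a PPT output has
fidelity at most 1/2 with the graph state. So it suffices that the noisy state is PPT at `v`. Both
graph state facts come from one identity: exchanging distinct `v`-coordinates of `x` and `y`
multiplies the `(x, y)` entry of the projector by the signs of `Z_N`, with `N` the neighbours of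
`v`. On the noise over `N` this exchanges `p` and `1 - p`, and positivity reduces to a scalar
inequality for each subset of `N`, the worst being the hypothesis. -/

open scoped ComplexOrder

/-! ### Partial transposition, local operations and copies. -/

section PartialTranspose

variable {V : Type*} [DecidableEq V]

/-- Exchanging the `v`-coordinates of two points of a product. -/
def swapAt {α : V → Type*} (v : V) : (∀ w, α w) × (∀ w, α w) ≃ (∀ w, α w) × (∀ w, α w) where
  toFun z := (Function.update z.1 v (z.2 v), Function.update z.2 v (z.1 v))
  invFun z := (Function.update z.1 v (z.2 v), Function.update z.2 v (z.1 v))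
  left_inv z := by simp
  right_inv z := by simp

/-- The partial transpose of an operator with respect to the system of party `v`. -/
def partialTranspose {α : V → Type*} (v : V) (ρ : Matrix (∀ w, α w) (∀ w, α w) ℂ) :
    Matrix (∀ w, α w) (∀ w, α w) ℂ :=
  Matrix.of fun x y => ρ (Function.update x v (y v)) (Function.update y v (x v))

theorem partialTranspose_apply {α : V → Type*} (v : V) (ρ : Matrix (∀ w, α w) (∀ w, α w) ℂ)
    (x y : ∀ w, α w) : partialTranspose v ρ x y =
      ρ (Function.update x v (y v)) (Function.update y v (x v)) := rfl

theorem partialTranspose_zero {α : V → Type*} (v : V) :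
    partialTranspose v (0 : Matrix (∀ w, α w) (∀ w, α w) ℂ) = 0 := rfl

theorem partialTranspose_sum {α : V → Type*} {ι : Type*} (v : V) (s : Finset ι)
    (ρ : ι → Matrix (∀ w, α w) (∀ w, α w) ℂ) :
    partialTranspose v (∑ i ∈ s, ρ i) = ∑ i ∈ s, partialTranspose v (ρ i) := by
  ext x y
  simp [partialTranspose_apply, Matrix.sum_apply]

theorem trace_partialTranspose {α : V → Type*} [Fintype (∀ w, α w)] (v : V)
    (ρ : Matrix (∀ w, α w) (∀ w, α w) ℂ) : (partialTranspose v ρ).trace = ρ.trace := by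
  simp [Matrix.trace, partialTranspose_apply]

/-- Partial transposition is symmetric for the trace pairing. -/
theorem sum_partialTranspose_mul {α : V → Type*} [Fintype (∀ w, α w)] (v : V)
    (ρ τ : Matrix (∀ w, α w) (∀ w, α w) ℂ) :
    ∑ x, ∑ y, partialTranspose v ρ x y * partialTranspose v τ x y = ∑ x, ∑ y, ρ x y * τ x y := by
  rw [← Fintype.sum_prod_type', ← Fintype.sum_prod_type']
  exact Fintype.sum_equiv (swapAt v) _ _ fun z => rfl

variable [Fintype V]

/-- Transposing party `v` conjugates the local operator that it applies. -/
theorem partialTranspose_localTensor_conj {d d' : V → ℕ} (v : V)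
    (M : ∀ w, Matrix (Fin (d' w)) (Fin (d w)) ℂ)
    (ρ : Matrix (∀ w, Fin (d w)) (∀ w, Fin (d w)) ℂ) :
    partialTranspose v (localTensor M * ρ * (localTensor M)ᴴ) =
      localTensor (Function.update M v ((M v).map star)) * partialTranspose v ρ *
        (localTensor (Function.update M v ((M v).map star)))ᴴ := by
  ext x y
  simp only [partialTranspose_apply, Matrix.mul_apply, Matrix.conjTranspose_apply,
    Finset.sum_mul, localTensor, Matrix.of_apply]
  rw [← Fintype.sum_prod_type', ← Fintype.sum_prod_type']
  refine Fintype.sum_equiv (swapAt v) _ _ fun z => ?_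
  obtain ⟨b, a⟩ := z
  -- Only the factors at `v` differ: there the starred and unstarred entries trade places, which
  -- conjugates `M v`.
  have key : (∏ w, M w (Function.update x v (y v) w) (a w)) *
        star (∏ w, M w (Function.update y v (x v) w) (b w)) =
      (∏ w, Function.update M v ((M v).map star) w (x w) (Function.update a v (b v) w)) *
        star (∏ w, Function.update M v ((M v).map star) w (y w)
          (Function.update b v (a v) w)) := by
    rw [star_prod, star_prod, ← Finset.prod_mul_distrib, ← Finset.prod_mul_distrib]
    refine Finset.prod_congr rfl fun w _ => ?_
    by_cases hw : w = v
    · subst hw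
      simp [mul_comm]
    · simp [hw]
  simp only [swapAt, Equiv.coe_fn_mk, Function.update_self, Function.update_idem,
    Function.update_eq_self]
  linear_combination (ρ a b) * key

theorem partialTranspose_output_posSemidef {e : V → ℕ} (v : V) {d : V → ℕ} (P : SLOCC e d)
    (ρ : Matrix (∀ w, Fin (d w)) (∀ w, Fin (d w)) ℂ) (h : (partialTranspose v ρ).PosSemidef) :
    (partialTranspose v (P.output ρ)).PosSemidef := by
  induction P with
  | accept => exact h
  | reject d =>
    simp only [SLOCC.output, partialTranspose_zero]
    exact Matrix.PosSemidef.zero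
  | round d k d' M hM next ih =>
    simp only [SLOCC.output, partialTranspose_sum]
    refine Matrix.posSemidef_sum _ fun o _ => ih o _ ?_
    rw [partialTranspose_localTensor_conj]
    exact h.mul_mul_conjTranspose_same _

theorem hadamard_posSemidef {ι : Type*} [Finite ι] {A B : Matrix ι ι ℂ} (hA : A.PosSemidef)
    (hB : B.PosSemidef) : (Matrix.hadamard A B).PosSemidef :=
  hA.hadamard hB

/-- Iterated Schur product theorem; the empty product is the all-ones matrix, of rank one. -/
theorem posSemidef_of_prod {ι κ : Type*} [Finite ι] (s : Finset κ) (A : κ → Matrix ι ι ℂ)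
    (h : ∀ k ∈ s, (A k).PosSemidef) :
    (Matrix.of fun x y => ∏ k ∈ s, A k x y : Matrix ι ι ℂ).PosSemidef := by
  classical
  induction s using Finset.induction_on with
  | empty =>
    convert Matrix.posSemidef_vecMulVec_self_star (fun _ : ι => (1 : ℂ)) using 1
    ext x y
    simp [Matrix.vecMulVec_apply]
  | insert k s hk ih =>
    convert hadamard_posSemidef (h k (Finset.mem_insert_self _ _))
      (ih fun j hj => h j (Finset.mem_insert_of_mem hj)) using 1
    ext x y
    simp [Finset.prod_insert hk]

theorem partialTranspose_copies_posSemidef (v : V) (n : ℕ)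
    (ρ : Matrix (V → Fin 2) (V → Fin 2) ℂ) (h : (partialTranspose v ρ).PosSemidef) :
    (partialTranspose v (copies n ρ)).PosSemidef := by
  convert posSemidef_of_prod Finset.univ
    (fun c : Fin n => (partialTranspose v ρ).submatrix
      (fun (x : V → Fin (2 ^ n)) w => finFunctionFinEquiv.symm (x w) c)
      (fun (x : V → Fin (2 ^ n)) w => finFunctionFinEquiv.symm (x w) c))
    (fun c _ => h.submatrix _) using 1
  ext x y
  simp only [partialTranspose_apply, copies, Matrix.of_apply, Matrix.submatrix_apply]
  refine Finset.prod_congr rfl fun c _ => ?_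
  congr 1 <;> ext w <;> by_cases hw : w = v
  all_goals first
    | (subst hw; simp)
    | simp [hw]

end PartialTranspose

/-! ### Graph states, `Z`-signs and the entries of the noisy state. -/

section GraphState

variable {V : Type*}

/-- The eigenvalue of `Z_S` on the basis vector `x`. -/
def zSign (S : Finset V) (x : V → Fin 2) : ℂ := ∏ v ∈ S, (-1 : ℂ) ^ (x v : ℕ)

theorem applyZ_eq (S : Finset V) (ψ : (V → Fin 2) → ℂ) (x : V → Fin 2) :
    applyZ S ψ x = zSign S x * ψ x := rfl

theorem neg_one_pow_mul_neg_one_pow (a b : Fin 2) :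
    (-1 : ℂ) ^ (a : ℕ) * (-1) ^ (b : ℕ) = if a = b then 1 else -1 := by
  fin_cases a <;> fin_cases b <;> simp

theorem star_zSign (S : Finset V) (x : V → Fin 2) : star (zSign S x) = zSign S x := by
  simp [zSign]

theorem zSign_mul_zSign (S : Finset V) (x y : V → Fin 2) :
    zSign S x * zSign S y = ∏ v ∈ S, (-1 : ℂ) ^ (x v : ℕ) * (-1) ^ (y v : ℕ) :=
  Finset.prod_mul_distrib.symm

theorem zSign_mul_self (S : Finset V) (x : V → Fin 2) : zSign S x * zSign S x = 1 := by
  rw [zSign_mul_zSign]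
  exact Finset.prod_eq_one fun v _ => by simp [neg_one_pow_mul_neg_one_pow]

theorem zSign_kernel_posSemidef [Finite V] (S : Finset V) :
    (Matrix.of fun x y => zSign S x * zSign S y : Matrix (V → Fin 2) (V → Fin 2) ℂ).PosSemidef := by
  convert Matrix.posSemidef_vecMulVec_self_star (zSign S) using 1
  ext x y
  simp [Matrix.vecMulVec_apply, star_zSign]

variable [DecidableEq V]

/-- Expands independent noise into rank-one kernels, whose coefficients decide positivity. -/
theorem prod_add_mul_zSign (R : Finset V) (a b : ℂ) (x y : V → Fin 2) :
    ∏ w ∈ R, (a + b * ((-1 : ℂ) ^ (x w : ℕ) * (-1) ^ (y w : ℕ))) =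
      ∑ S ∈ R.powerset, b ^ S.card * a ^ (R \ S).card * (zSign S x * zSign S y) := by
  simp_rw [add_comm a]
  rw [Finset.prod_add]
  refine Finset.sum_congr rfl fun S _ => ?_
  rw [Finset.prod_mul_distrib, zSign_mul_zSign, Finset.prod_const, Finset.prod_const]
  ring

theorem zSign_update_of_notMem {S : Finset V} {v : V} (hv : v ∉ S) (x : V → Fin 2) (b : Fin 2) :
    zSign S (Function.update x v b) = zSign S x :=
  Finset.prod_congr rfl fun w hw => by
    rw [Function.update_of_ne (ne_of_mem_of_not_mem hw hv)]

variable [Fintype V]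

theorem sum_zSign_mul_zSign (x y : V → Fin 2) :
    ∑ S : Finset V, zSign S x * zSign S y = if x = y then 2 ^ Fintype.card V else 0 := by
  have h := prod_add_mul_zSign Finset.univ 1 1 x y
  simp only [one_pow, one_mul, Finset.powerset_univ] at h
  rw [← h]
  split_ifs with hxy
  · subst hxy
    simp [neg_one_pow_mul_neg_one_pow, one_add_one_eq_two]
  · obtain ⟨w, hw⟩ := Function.ne_iff.mp hxy
    exact Finset.prod_eq_zero (Finset.mem_univ w) (by simp [neg_one_pow_mul_neg_one_pow, hw])

variable (G : SimpleGraph V) [DecidableRel G.Adj]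

theorem star_graphState (x : V → Fin 2) : star (graphState G x) = graphState G x := by
  simp only [graphState, star_mul', star_prod]
  congr 1
  · exact Finset.prod_congr rfl fun e _ => by split_ifs <;> simp
  · simp

theorem graphState_mul_self (x : V → Fin 2) :
    graphState G x * graphState G x = (2 ^ Fintype.card V)⁻¹ := by
  have h2 : (((Real.sqrt 2 : ℝ) : ℂ)⁻¹) * ((Real.sqrt 2 : ℝ) : ℂ)⁻¹ = 2⁻¹ := by
    rw [← mul_inv, ← Complex.ofReal_mul, Real.mul_self_sqrt zero_le_two]
    simp
  rw [graphState, mul_mul_mul_comm, ← Finset.prod_mul_distrib, ← Finset.prod_mul_distrib, h2]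
  rw [Finset.prod_eq_one fun e _ => by split_ifs <;> simp]
  simp

/-- Flipping the qubit `v` of a graph state amounts to applying `Z` to the neighbours of `v`. -/
theorem graphState_update_of_ne (v : V) (x : V → Fin 2) (b : Fin 2) (hb : b ≠ x v) :
    graphState G (Function.update x v b) =
      zSign (G.neighborFinset v) x * graphState G x := by
  have hsub : G.incidenceFinset v ⊆ G.edgeFinset := G.incidenceFinset_subset v
  have hinc : ∀ z : V → Fin 2,
      (∏ e ∈ G.incidenceFinset v, if ∀ w ∈ e, z w = 1 then (-1 : ℂ) else 1) =
        if z v = 1 then zSign (G.neighborFinset v) z else 1 := by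
    intro z
    have himg : G.incidenceFinset v = (G.neighborFinset v).image fun w => s(v, w) := by
      ext e
      induction e with | h a c =>
      simp only [SimpleGraph.mem_incidenceFinset, SimpleGraph.mk'_mem_incidenceSet_iff,
        Finset.mem_image, SimpleGraph.mem_neighborFinset, Sym2.eq_iff]
      constructor
      · rintro ⟨hac, rfl | rfl⟩
        · exact ⟨c, hac, Or.inl ⟨rfl, rfl⟩⟩
        · exact ⟨a, hac.symm, Or.inr ⟨rfl, rfl⟩⟩
      · rintro ⟨w, hw, ⟨rfl, rfl⟩ | ⟨rfl, rfl⟩⟩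
        · exact ⟨hw, Or.inl rfl⟩
        · exact ⟨hw.symm, Or.inr rfl⟩
    rw [himg, Finset.prod_image fun a _ c _ hac => Sym2.congr_right.mp hac]
    split_ifs with hz
    · refine Finset.prod_congr rfl fun w _ => ?_
      have : ∀ a : Fin 2, (if a = 1 then (-1 : ℂ) else 1) = (-1) ^ (a : ℕ) := by
        intro a; fin_cases a <;> simp
      simp [hz, this]
    · exact Finset.prod_eq_one fun w _ => by simp [hz]
  have hrest : (∏ e ∈ G.edgeFinset \ G.incidenceFinset v,
        if ∀ w ∈ e, Function.update x v b w = 1 then (-1 : ℂ) else 1) =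
      ∏ e ∈ G.edgeFinset \ G.incidenceFinset v, if ∀ w ∈ e, x w = 1 then (-1 : ℂ) else 1 := by
    refine Finset.prod_congr rfl fun e he => ?_
    have hve : v ∉ e := by
      intro hve
      rw [Finset.mem_sdiff] at he
      exact he.2 ((G.mem_incidenceFinset v e).mpr ⟨SimpleGraph.mem_edgeFinset.mp he.1, hve⟩)
    refine if_congr (forall₂_congr fun w hw => ?_) rfl rfl
    rw [Function.update_of_ne (ne_of_mem_of_not_mem hw hve)]
  have hN : zSign (G.neighborFinset v) (Function.update x v b) = zSign (G.neighborFinset v) x :=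
    zSign_update_of_notMem (by simp) x b
  simp only [graphState]
  rw [← Finset.prod_sdiff hsub, ← Finset.prod_sdiff hsub, hrest, hinc, hinc, hN,
    Function.update_self]
  have hsq := zSign_mul_self (G.neighborFinset v) x
  generalize hxv : x v = a at *
  fin_cases a <;> fin_cases b <;> simp at hb ⊢
  · ring
  · linear_combination (-(∏ e ∈ G.edgeFinset \ G.incidenceFinset v,
      if ∀ w ∈ e, x w = 1 then (-1 : ℂ) else 1) * (((Real.sqrt 2 : ℝ) : ℂ) ^ Fintype.card V)⁻¹) * hsq

theorem graphState_update_mul_graphState_update (v : V) (x y : V → Fin 2) :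
    graphState G (Function.update x v (y v)) * graphState G (Function.update y v (x v)) =
      graphState G x * graphState G y * if x v = y v then 1 else
        zSign (G.neighborFinset v) x * zSign (G.neighborFinset v) y := by
  split_ifs with h
  · rw [← h, Function.update_eq_self, h, Function.update_eq_self, mul_one]
  · rw [graphState_update_of_ne G v x _ (Ne.symm h), graphState_update_of_ne G v y _ h]
    ring

theorem noisyGraphState_apply (p : ℝ) (x y : V → Fin 2) :
    noisyGraphState G p x y = graphState G x * graphState G y *
      ∏ w, ((1 - p : ℂ) + p * ((-1 : ℂ) ^ (x w : ℕ) * (-1) ^ (y w : ℕ))) := by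
  rw [prod_add_mul_zSign, Finset.mul_sum, noisyGraphState, Matrix.sum_apply, Finset.powerset_univ]
  refine Finset.sum_congr rfl fun S _ => ?_
  rw [Matrix.smul_apply, Matrix.vecMulVec_apply, Pi.star_apply, applyZ_eq, applyZ_eq, star_mul',
    star_zSign, star_graphState, Finset.card_univ_sdiff, smul_eq_mul]
  push_cast
  ring

theorem partialTranspose_noisyGraphState_apply (v : V) (p : ℝ) (x y : V → Fin 2) :
    partialTranspose v (noisyGraphState G p) x y = graphState G x * graphState G y *
      (∏ w ∈ Finset.univ \ insert v (G.neighborFinset v),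
        ((1 - p : ℂ) + p * ((-1 : ℂ) ^ (x w : ℕ) * (-1) ^ (y w : ℕ)))) *
      ∑ S ∈ (G.neighborFinset v).powerset, zSign S x * zSign S y *
        if x v = y v then (p : ℂ) ^ S.card * (1 - p) ^ (G.neighborFinset v \ S).card
        else (1 - 2 * p) * ((1 - p : ℂ) ^ S.card * p ^ (G.neighborFinset v \ S).card) := by
  have hprod : ∏ w, ((1 - p : ℂ) + p * ((-1 : ℂ) ^ (Function.update x v (y v) w : ℕ) *
        (-1) ^ (Function.update y v (x v) w : ℕ))) =
      ∏ w, ((1 - p : ℂ) + p * ((-1 : ℂ) ^ (x w : ℕ) * (-1) ^ (y w : ℕ))) := by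
    refine Finset.prod_congr rfl fun w _ => ?_
    by_cases hw : w = v
    · subst hw
      simp [mul_comm]
    · simp [hw]
  rw [partialTranspose_apply, noisyGraphState_apply, hprod,
    graphState_update_mul_graphState_update,
    ← Finset.prod_sdiff (Finset.subset_univ (insert v (G.neighborFinset v))),
    Finset.prod_insert (by simp), neg_one_pow_mul_neg_one_pow (x v)]
  rw [mul_assoc (graphState G x * graphState G y), mul_left_comm (ite _ _ _) (∏ w ∈ _, _),
    mul_assoc (graphState G x * graphState G y)]
  congr 2
  split_ifs with h
  · have := prod_add_mul_zSign (G.neighborFinset v) (1 - p : ℂ) p x y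
    rw [this, Finset.mul_sum, Finset.mul_sum]
    exact Finset.sum_congr rfl fun S _ => by ring
  -- For a sign `s`, `s * (1 - p + p * s) = p + (1 - p) * s`, so the weights swap; the factor `1 - 2
  -- * p` is the noise at `v` itself.
  · have h1 := prod_add_mul_zSign (G.neighborFinset v) (p : ℂ) (1 - p) x y
    have h2 : zSign (G.neighborFinset v) x * zSign (G.neighborFinset v) y *
        ∏ w ∈ G.neighborFinset v, ((1 - p : ℂ) + p * ((-1 : ℂ) ^ (x w : ℕ) * (-1) ^ (y w : ℕ))) =
        ∏ w ∈ G.neighborFinset v, ((p : ℂ) + (1 - p) * ((-1 : ℂ) ^ (x w : ℕ) * (-1) ^ (y w : ℕ))) := by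
      rw [zSign_mul_zSign, ← Finset.prod_mul_distrib]
      refine Finset.prod_congr rfl fun w _ => ?_
      rw [neg_one_pow_mul_neg_one_pow]
      split_ifs <;> ring
    rw [mul_left_comm, h2, h1, Finset.mul_sum]
    exact Finset.sum_congr rfl fun S _ => by ring

end GraphState

/-- The inequality at `s = D` implies the one at every `s ≤ D`. -/
theorem one_sub_two_mul_pow_mul_pow_le {p : ℝ} (hp0 : 0 ≤ p) (hp : p ≤ 1 / 2) {D a b : ℕ}
    (hD : a + b = D) (h : 2 * (1 - p) ^ (D + 1) ≤ (1 - p) ^ D + p ^ D) :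
    (1 - 2 * p) * ((1 - p) ^ a * p ^ b) ≤ p ^ a * (1 - p) ^ b := by
  have hq : p ≤ 1 - p := by linarith
  have hq0 : 0 < 1 - p := by linarith
  have hD' : (1 - 2 * p) * (1 - p) ^ D ≤ p ^ D := by
    rw [pow_succ] at h
    linarith
  rcases le_total a b with hab | hab
  · obtain ⟨m, rfl⟩ := Nat.exists_eq_add_of_le hab
    have h1 : p ^ m ≤ (1 - p) ^ m := pow_le_pow_left₀ hp0 hq m
    have h2 : (1 - p) ^ a * p ^ (a + m) ≤ p ^ a * (1 - p) ^ (a + m) := by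
      rw [pow_add, pow_add]
      have := mul_le_mul_of_nonneg_left h1 (by positivity : 0 ≤ p ^ a * (1 - p) ^ a)
      linarith
    exact (mul_le_of_le_one_left (by positivity) (by linarith)).trans h2
  · obtain ⟨m, rfl⟩ := Nat.exists_eq_add_of_le hab
    have h1 : (1 - 2 * p) * (1 - p) ^ m ≤ p ^ m := by
      have h3 : p ^ (b + b) ≤ (1 - p) ^ (b + b) := pow_le_pow_left₀ hp0 hq _
      -- Here `D = 2 * b + m`: lowering the exponent from `D` to `m` only weakens the hypothesis, as
      -- `p ≤ 1 - p`.
      have h4 : (1 - p) ^ (b + b) * ((1 - 2 * p) * (1 - p) ^ m) ≤ (1 - p) ^ (b + b) * p ^ m := by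
        calc (1 - p) ^ (b + b) * ((1 - 2 * p) * (1 - p) ^ m) = (1 - 2 * p) * (1 - p) ^ D := by
              rw [← hD]; ring
          _ ≤ p ^ D := hD'
          _ = p ^ (b + b) * p ^ m := by rw [← hD]; ring
          _ ≤ _ := by gcongr
      exact le_of_mul_le_mul_left h4 (by positivity)
    have := mul_le_mul_of_nonneg_left h1 (by positivity : 0 ≤ p ^ b * (1 - p) ^ b)
    rw [pow_add, pow_add]
    linarith

/-! ### PPT of the noisy state and the fidelity bound. -/

section Purification

variable {V : Type*} [Fintype V] [DecidableEq V] (G : SimpleGraph V) [DecidableRel G.Adj]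

theorem partialTranspose_noisyGraphState_posSemidef (v : V) {p : ℝ} (hp0 : 0 ≤ p) (hp : p ≤ 1 / 2)
    (h : 2 * (1 - p) ^ (G.degree v + 1) ≤ (1 - p) ^ G.degree v + p ^ G.degree v) :
    (partialTranspose v (noisyGraphState G p)).PosSemidef := by
  set N := G.neighborFinset v with hN
  set R := Finset.univ \ insert v N
  have hq0 : 0 ≤ 1 - p := by linarith
  have hψ := Matrix.posSemidef_vecMulVec_self_star (graphState G)
  have hrest : (∑ S ∈ R.powerset, ((p ^ S.card * (1 - p) ^ (R \ S).card : ℝ) : ℂ) •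
      (Matrix.of fun x y => zSign S x * zSign S y :
        Matrix (V → Fin 2) (V → Fin 2) ℂ)).PosSemidef :=
    Matrix.posSemidef_sum _ fun S _ => (zSign_kernel_posSemidef S).smul
      (Complex.zero_le_real.mpr (by positivity))
  -- A kernel equal to `α` where `x v = y v` and `β` elsewhere is `β` times all-ones plus `α - β`
  -- times a block identity, hence positive when `0 ≤ β ≤ α`.
  have hnbr : (∑ S ∈ N.powerset,
      ((((1 - 2 * p) * ((1 - p) ^ S.card * p ^ (N \ S).card) : ℝ) : ℂ) •
          (Matrix.of fun x y => zSign S x * zSign S y : Matrix (V → Fin 2) (V → Fin 2) ℂ) +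
        ((p ^ S.card * (1 - p) ^ (N \ S).card -
            (1 - 2 * p) * ((1 - p) ^ S.card * p ^ (N \ S).card) : ℝ) : ℂ) •
          Matrix.hadamard (Matrix.of fun x y => zSign S x * zSign S y)
            ((1 : Matrix (Fin 2) (Fin 2) ℂ).submatrix (fun x : V → Fin 2 => x v)
              (fun x : V → Fin 2 => x v)))).PosSemidef := by
    refine Matrix.posSemidef_sum _ fun S hS => Matrix.PosSemidef.add ?_ ?_
    · refine (zSign_kernel_posSemidef S).smul (Complex.zero_le_real.mpr ?_)
      exact mul_nonneg (by linarith) (by positivity)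
    · refine ((zSign_kernel_posSemidef S).hadamard (Matrix.PosSemidef.one.submatrix _)).smul
        (Complex.zero_le_real.mpr (sub_nonneg.mpr ?_))
      refine one_sub_two_mul_pow_mul_pow_le hp0 hp ?_ h
      rw [← G.card_neighborFinset_eq_degree v, ← hN, add_comm]
      exact Finset.card_sdiff_add_card_eq_card (Finset.mem_powerset.mp hS)
  convert hadamard_posSemidef (hadamard_posSemidef hψ hrest) hnbr using 1
  ext x y
  rw [partialTranspose_noisyGraphState_apply, prod_add_mul_zSign]
  simp only [Matrix.hadamard_apply, Matrix.vecMulVec_apply, Pi.star_apply, star_graphState,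
    Matrix.sum_apply, Matrix.smul_apply, Matrix.add_apply, Matrix.of_apply, smul_eq_mul,
    Matrix.submatrix_apply, Matrix.one_apply]
  congr 1
  · congr 1
    exact Finset.sum_congr rfl fun S _ => by push_cast; ring
  · refine Finset.sum_congr rfl fun S _ => ?_
    split_ifs <;> push_cast <;> ring

/-- A state with positive partial transpose at a non-isolated vertex `v` has fidelity at most `1/2`
with the graph state. -/
theorem graphState_fidelity_le_of_partialTranspose_posSemidef (v : V) (hv : 1 ≤ G.degree v)
    (σ : Matrix (V → Fin 2) (V → Fin 2) ℂ) (h : (partialTranspose v σ).PosSemidef) :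
    2 * (star (graphState G) ⬝ᵥ (σ *ᵥ graphState G)).re ≤ σ.trace.re := by
  set N := G.neighborFinset v with hN
  set τ := partialTranspose v σ with hτ
  have hvN : v ∉ N := by simp [hN]
  have hNne : N.Nonempty := by
    rw [← Finset.card_pos, hN, G.card_neighborFinset_eq_degree]
    exact hv
  let F : Finset V → ℂ := fun S =>
    ∑ x, ∑ y, τ x y * (graphState G x * graphState G y * (zSign S x * zSign S y))
  have hF : ∀ S, 0 ≤ (F S).re := by
    intro S
    have h0 := h.dotProduct_mulVec_nonneg (applyZ S (graphState G))
    have : F S = star (applyZ S (graphState G)) ⬝ᵥ (τ *ᵥ applyZ S (graphState G)) := by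
      simp only [F, dotProduct, Matrix.mulVec, Finset.mul_sum, Pi.star_apply, applyZ_eq, star_mul',
        star_zSign, star_graphState]
      exact Finset.sum_congr rfl fun x _ => Finset.sum_congr rfl fun y _ => by ring
    rw [this]
    exact (Complex.nonneg_iff.mp h0).1
  -- The vectors `Z_S ψ` form an orthonormal basis, and partial transposition keeps the trace.
  have htr : σ.trace = ∑ S, F S := by
    rw [← trace_partialTranspose v σ, ← hτ]
    simp only [F]
    rw [Finset.sum_comm]
    refine Finset.sum_congr rfl fun x _ => ?_
    rw [Finset.sum_comm]
    simp_rw [← Finset.mul_sum, sum_zSign_mul_zSign]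
    simp [graphState_mul_self]
  -- With `s` the sign at `v` and `t` that of `Z_N`, twice the factor "1 if `s = 1`, else `t`" is `1
  -- + s + t - s * t`.
  have hfid : 2 * (star (graphState G) ⬝ᵥ (σ *ᵥ graphState G)) =
      F ∅ + F {v} + F N - F (insert v N) := by
    have h1 : star (graphState G) ⬝ᵥ (σ *ᵥ graphState G) =
        ∑ x, ∑ y, σ x y * (Matrix.of fun x y => graphState G x * graphState G y :
          Matrix (V → Fin 2) (V → Fin 2) ℂ) x y := by
      simp only [dotProduct, Matrix.mulVec, Finset.mul_sum, Pi.star_apply, star_graphState,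
        Matrix.of_apply]
      exact Finset.sum_congr rfl fun x _ => Finset.sum_congr rfl fun y _ => by ring
    rw [h1, ← sum_partialTranspose_mul v, ← hτ]
    simp only [F, Finset.mul_sum, ← Finset.sum_add_distrib, ← Finset.sum_sub_distrib]
    refine Finset.sum_congr rfl fun x _ => Finset.sum_congr rfl fun y _ => ?_
    rw [partialTranspose_apply, Matrix.of_apply, graphState_update_mul_graphState_update, ← hN]
    simp only [zSign_mul_zSign, Finset.prod_insert hvN, Finset.prod_empty, Finset.prod_singleton]
    rw [neg_one_pow_mul_neg_one_pow (x v)]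
    split_ifs <;> ring
  have h3 : (F ∅).re + (F {v}).re + (F N).re ≤ ∑ S, (F S).re := by
    have hne1 : (∅ : Finset V) ≠ {v} := (Finset.singleton_ne_empty v).symm
    have hne2 : (∅ : Finset V) ≠ N := hNne.ne_empty.symm
    have hne3 : ({v} : Finset V) ≠ N := fun h => hvN (h ▸ Finset.mem_singleton_self v)
    have : ∑ S ∈ ({∅, {v}, N} : Finset (Finset V)), (F S).re =
        (F ∅).re + (F {v}).re + (F N).re := by
      rw [Finset.sum_insert (by simp [hne1, hne2]), Finset.sum_pair hne3, add_assoc]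
    rw [← this]
    exact Finset.sum_le_sum_of_subset_of_nonneg (Finset.subset_univ _) fun S _ _ => hF S
  have h4 := congrArg Complex.re hfid
  have h5 := hF (insert v N)
  rw [htr, Complex.re_sum]
  simp only [Complex.sub_re, Complex.add_re, Complex.mul_re, Complex.re_ofNat, Complex.im_ofNat,
    zero_mul, sub_zero] at h4
  linarith

end Purification

theorem mainTheorem3 {V : Type*} [Fintype V] [DecidableEq V] (G : SimpleGraph V)
    [DecidableRel G.Adj] (hG : 1 ≤ G.minDegree) (p : ℝ) (hp0 : 0 ≤ p) (hp : p ≤ 1 / 2)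
    (h : 2 * (1 - p) ^ (G.minDegree + 1) ≤ (1 - p) ^ G.minDegree + p ^ G.minDegree) :
    ¬ Purifiable (noisyGraphState G p) (graphState G) := by
  intro hpur
  -- Any `ε < 1/2` contradicts the fidelity bound.
  obtain ⟨n, P, hpos, hfid⟩ := hpur (1 / 4) (by norm_num)
  -- On an empty vertex set `minDegree` defaults to 0.
  have : Nonempty V := by
    by_contra hV
    rw [not_nonempty_iff] at hV
    simp at hG
  obtain ⟨v, hv⟩ := G.exists_minimal_degree_vertex
  rw [hv] at h hG
  have hle := graphState_fidelity_le_of_partialTranspose_posSemidef G v hG _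
    (partialTranspose_output_posSemidef v P _ (partialTranspose_copies_posSemidef v n _
      (partialTranspose_noisyGraphState_posSemidef G v hp0 hp h)))
  linarith
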